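/- **Theorem 2.2 (Congenial holes).** All graphs are finite, undirected and simple. A graph is an *interval graph* if its vertices can be assigned to nonempty closed intervals of the real line such that two distinct vertices are adjacent if and only if their intervals intersect. A set $X$ of vertices of a graph $G$ is a *minimal forbidden set* if the induced subgraph $G[X]$ is not an interval graph, but $G[Y]$ is an interval graph for every proper subset $Y\subsetneq X$. A set $M\subseteq V(G)$ is a *module* of $G$ if all vertices of $M$ have the same neighbours outside $M$; it is *nontrivial* if $1<|M|<|V(G)|$. The graph $G$ is *reduced* if it has no minimal forbidden set of at most $10$ vertices and every nontrivial module of $G$ induces a clique. A *hole* of $G$ is a chordless cycle of $G$ of length at least $4$, which we identify with its vertex set. For $U\subseteq V(G)$, let $N[U]=\bigcup_{v\in U}(N(v)\cup\{v\})$ be its closed neighbourhood. Two holes $H_1$ and $H_2$ of $G$ are *congenial* if $H_1\subseteq N[H_2]$ and $H_2\subseteq N[H_1]$. If $G$ is a reduced graph, then any two holes of $G$ are congenial. -/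

import Mathlib

namespace HolePaper

/-- `G` is an interval graph: its vertices can be assigned (nonempty, closed) intervals of the real
line so that two distinct vertices are adjacent iff their intervals intersect. -/
def IsIntervalGraph {V : Type*} (G : SimpleGraph V) : Prop :=
  ∃ l r : V → ℝ, (∀ v, l v ≤ r v) ∧
    ∀ u v, u ≠ v → (G.Adj u v ↔ (Set.Icc (l u) (r u) ∩ Set.Icc (l v) (r v)).Nonempty)

/-- `X` is a minimal forbidden set: it does not induce an interval graph, but each of its proper
subsets does. -/
def IsMinimalForbidden {V : Type*} (G : SimpleGraph V) (X : Finset V) : Prop :=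
  ¬ IsIntervalGraph (G.induce (X : Set V)) ∧
    ∀ Y : Finset V, Y ⊂ X → IsIntervalGraph (G.induce (Y : Set V))

/-- `G` is prereduced: it has no minimal forbidden set of at most `10` vertices. -/
def IsPrereduced {V : Type*} (G : SimpleGraph V) : Prop :=
  ¬ ∃ X : Finset V, IsMinimalForbidden G X ∧ X.card ≤ 10

/-- `M` is a module: all vertices of `M` have the same neighbours outside `M`. -/
def IsModule {V : Type*} (G : SimpleGraph V) (M : Set V) : Prop :=
  ∀ u ∈ M, ∀ v ∈ M, ∀ x ∉ M, (G.Adj u x ↔ G.Adj v x)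

/-- `M` is a nontrivial module: a module with at least two vertices that is not the whole
vertex set. -/
def IsNontrivialModule {V : Type*} (G : SimpleGraph V) (M : Set V) : Prop :=
  IsModule G M ∧ M.Nontrivial ∧ M ≠ Set.univ

/-- `G` is reduced: it is prereduced and every nontrivial module of it induces a clique. -/
def IsReduced {V : Type*} (G : SimpleGraph V) : Prop :=
  IsPrereduced G ∧ ∀ M : Set V, IsNontrivialModule G M → G.IsClique M

/-- `H` is (the vertex set of) a hole: a chordless cycle of length at least `4`, i.e. an induced
copy of the cycle `C_n` for some `n ≥ 4`. -/
def IsHole {V : Type*} (G : SimpleGraph V) (H : Set V) : Prop :=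
  ∃ n : ℕ, 4 ≤ n ∧ ∃ f : SimpleGraph.cycleGraph n ↪g G, Set.range f = H

/-- The closed neighbourhood `N[U] = ⋃_{v ∈ U} (N(v) ∪ {v})` of a vertex set `U`. -/
def closedNeighborhood {V : Type*} (G : SimpleGraph V) (U : Set V) : Set V :=
  ⋃ v ∈ U, insert v (G.neighborSet v)

/-- The vertex sets `H₁` and `H₂` (of two holes) are congenial: each is contained in the closed
neighbourhood of the other. -/
def Congenial {V : Type*} (G : SimpleGraph V) (H₁ H₂ : Set V) : Prop :=
  H₁ ⊆ closedNeighborhood G H₂ ∧ H₂ ⊆ closedNeighborhood G H₁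

end HolePaper

/-! A graph without small forbidden sets contains no `C₄`, no `C₅` and no small asteroidal triple.
A vertex that is mixed on a hole is therefore attached to it at a single vertex, at a single edge,
or at both ends of a gap, and only the last is possible if the vertex has a neighbour off `N[H]`.
It follows that the vertices mixed on `H`, together with the vertices off `N[H]` adjacent to one
of them, form a module, which is not a clique since it contains `H`. Hence it is everything, and
no vertex is complete to `H`. Now let `u` lie off `N[H]`. Its component off `N[H]` is a module,
hence a clique, and the vertices mixed on `H` that are adjacent to `u` are pairwise adjacent. So
`u` is simplicial, whereas no vertex of a hole is. -/

namespace HolePaper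

variable {V : Type*} {G : SimpleGraph V}

theorem IsIntervalGraph.exists_endpoints (hG : IsIntervalGraph G) :
    ∃ l r : V → ℝ, (∀ v, l v ≤ r v) ∧ ∀ u v, u ≠ v → (G.Adj u v ↔ l u ≤ r v ∧ l v ≤ r u) := by
  obtain ⟨l, r, hlr, hadj⟩ := hG
  refine ⟨l, r, hlr, fun u v huv => (hadj u v huv).trans ?_⟩
  rw [Set.Icc_inter_Icc, Set.nonempty_Icc, sup_le_iff, le_inf_iff, le_inf_iff]
  exact ⟨fun h => ⟨h.1.2, h.2.1⟩, fun h => ⟨⟨hlr u, h.1⟩, h.2, hlr v⟩⟩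

/- The vertex whose interval ends first is simplicial: the intervals meeting its interval all
contain its right endpoint. -/
theorem IsIntervalGraph.exists_isClique_neighborSet [Finite V] [Nonempty V]
    (hG : IsIntervalGraph G) : ∃ v, G.IsClique (G.neighborSet v) := by
  obtain ⟨l, r, -, hadj⟩ := hG.exists_endpoints
  obtain ⟨v, hv⟩ := Finite.exists_min r
  refine ⟨v, fun a ha b hb hab => (hadj a b hab).2 ⟨?_, ?_⟩⟩
  · exact ((hadj v a ha.ne).1 ha).2.trans (hv b)
  · exact ((hadj v b hb.ne).1 hb).2.trans (hv a)

theorem right_lt_left_of_walk {l r : V → ℝ}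
    (hadj : ∀ u v, u ≠ v → (G.Adj u v ↔ l u ≤ r v ∧ l v ≤ r u)) {a b c : V} (hc : l c ≤ r c)
    (p : G.Walk a b) (hp : ∀ v ∈ p.support, ¬ G.Adj v c) (hac : a ≠ c) (ha : r a < l c) :
    r b < l c := by
  induction p with
  | nil => exact ha
  | @cons a d b had p ih =>
    have hpd : ∀ v ∈ p.support, ¬ G.Adj v c := fun v hv => hp v (by simp [hv])
    have hdc : d ≠ c := by
      rintro rfl
      exact hp a (by simp) had
    have hmeet := (hadj a d had.ne).1 had
    have hmiss := mt (hadj d c hdc).2 (hpd d p.start_mem_support)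
    refine ih hpd hdc ?_
    by_contra! hd
    exact hmiss ⟨by linarith, hd⟩

/- Of three disjoint intervals one lies between the other two, and a walk between the outer ones
has to meet it. -/
theorem IsIntervalGraph.no_asteroidal_triple (hG : IsIntervalGraph G) {a b c : V}
    (hab : a ≠ b) (hbc : b ≠ c) (hca : c ≠ a)
    (p : G.Walk a b) (hp : ∀ v ∈ p.support, ¬ G.Adj v c)
    (q : G.Walk b c) (hq : ∀ v ∈ q.support, ¬ G.Adj v a)
    (s : G.Walk c a) (hs : ∀ v ∈ s.support, ¬ G.Adj v b) : False := by
  obtain ⟨l, r, hlr, hadj⟩ := hG.exists_endpoints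
  have not_between {x y z : V} (w : G.Walk x z) (hw : ∀ v ∈ w.support, ¬ G.Adj v y)
      (hxy : x ≠ y) : r x < l y → ¬ r y < l z := fun h₁ h₂ => by
    have := right_lt_left_of_walk hadj (hlr y) w hw hxy h₁
    linarith [hlr y, hlr z]
  have disjoint {x y : V} (hxy : x ≠ y) (h : ¬ G.Adj x y) : r x < l y ∨ r y < l x := by
    rw [hadj x y hxy, not_and_or, not_le, not_le] at h
    exact h.symm
  have mem_reverse {x y z : V} {w : G.Walk x y} (hw : ∀ v ∈ w.support, ¬ G.Adj v z) :
      ∀ v ∈ w.reverse.support, ¬ G.Adj v z := by simpa using hw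
  have := disjoint hab (hs a s.end_mem_support)
  have := disjoint hbc (hp b p.end_mem_support)
  have := disjoint hca (hq c q.end_mem_support)
  have := not_between p hp hca.symm
  have := not_between p.reverse (mem_reverse hp) hbc
  have := not_between q hq hab.symm
  have := not_between q.reverse (mem_reverse hq) hca
  have := not_between s hs hbc.symm
  have := not_between s.reverse (mem_reverse hs) hab
  tauto

/-- Every set of at most seven vertices induces an interval graph. Seven is the order of the
largest obstructions needed below, the long claw and the whipping top. -/
def IsLocallyInterval (G : SimpleGraph V) : Prop :=
  ∀ X : Finset V, X.card ≤ 7 → IsIntervalGraph (G.induce (X : Set V))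

theorem isLocallyInterval_of_seven_lt_card
    (hG : ∀ X : Finset V, IsMinimalForbidden G X → 7 < X.card) : IsLocallyInterval G := by
  intro X
  induction X using Finset.strongInduction with
  | H X ih =>
    intro hX
    by_contra hX'
    refine (hG X ⟨hX', fun Y hY => ih Y hY ?_⟩).not_ge hX
    exact (Finset.card_le_card hY.subset).trans hX

/-- `a b c d` is an induced path. The conditions force the four vertices to be distinct. -/
structure IsInducedP4 (G : SimpleGraph V) (a b c d : V) : Prop where
  ab : G.Adj a b
  bc : G.Adj b c
  cd : G.Adj c d
  not_ac : ¬ G.Adj a c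
  not_ad : ¬ G.Adj a d
  not_bd : ¬ G.Adj b d

/-- `a b c d e` is an induced path. -/
structure IsInducedP5 (G : SimpleGraph V) (a b c d e : V) : Prop
    extends IsInducedP4 G a b c d where
  de : G.Adj d e
  not_ae : ¬ G.Adj a e
  not_be : ¬ G.Adj b e
  not_ce : ¬ G.Adj c e

namespace IsLocallyInterval

theorem exists_simplicial_mem (hG : IsLocallyInterval G) {L : List V} (hL : L.length ≤ 7)
    (hne : L ≠ []) :
    ∃ v ∈ L, ∀ x ∈ L, ∀ y ∈ L, G.Adj v x → G.Adj v y → x ≠ y → G.Adj x y := by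
  classical
  have : Nonempty (L.toFinset : Set V) := (List.toFinset_nonempty_iff L).2 hne |>.to_subtype
  obtain ⟨⟨v, hv⟩, hclique⟩ :=
    (hG L.toFinset ((List.toFinset_card_le L).trans hL)).exists_isClique_neighborSet
  have mem {x : V} (hx : x ∈ L) : x ∈ (L.toFinset : Set V) := by simpa using hx
  refine ⟨v, by simpa using hv, fun x hx y hy hvx hvy hxy => ?_⟩
  exact @hclique ⟨x, mem hx⟩ hvx ⟨y, mem hy⟩ hvy (by simpa using hxy)

theorem no_asteroidal_triple (hG : IsLocallyInterval G) {L : List V} (hL : L.length ≤ 7)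
    {a b c : V} (hab : a ≠ b) (hbc : b ≠ c) (hca : c ≠ a)
    (p : G.Walk a b) (hp : ∀ v ∈ p.support, v ∈ L ∧ ¬ G.Adj v c)
    (q : G.Walk b c) (hq : ∀ v ∈ q.support, v ∈ L ∧ ¬ G.Adj v a)
    (s : G.Walk c a) (hs : ∀ v ∈ s.support, v ∈ L ∧ ¬ G.Adj v b) : False := by
  classical
  have mem {x y z : V} {w : G.Walk x y} (hw : ∀ v ∈ w.support, v ∈ L ∧ ¬ G.Adj v z) :
      ∀ v ∈ w.support, v ∈ (L.toFinset : Set V) := fun v hv => by simpa using (hw v hv).1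
  have avoids {x y z : V} {w : G.Walk x y} (hw : ∀ v ∈ w.support, v ∈ L ∧ ¬ G.Adj v z)
      (hz : z ∈ (L.toFinset : Set V)) :
      ∀ v ∈ (w.induce _ (mem hw)).support, ¬ (G.induce _).Adj v ⟨z, hz⟩ :=
    fun v hv => (hw v (by rwa [SimpleGraph.Walk.support_induce, List.mem_attachWith] at hv)).2
  exact (hG L.toFinset ((List.toFinset_card_le L).trans hL)).no_asteroidal_triple
    (Subtype.coe_ne_coe.1 hab) (Subtype.coe_ne_coe.1 hbc) (Subtype.coe_ne_coe.1 hca)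
    (p.induce _ (mem hp)) (avoids hp _) (q.induce _ (mem hq)) (avoids hq _)
    (s.induce _ (mem hs)) (avoids hs _)

theorem no_four_hole (hG : IsLocallyInterval G) {a b c d : V}
    (hab : G.Adj a b) (hbc : G.Adj b c) (hcd : G.Adj c d) (hda : G.Adj d a)
    (hac : ¬ G.Adj a c) (hbd : ¬ G.Adj b d) (hac' : a ≠ c) (hbd' : b ≠ d) : False := by
  obtain ⟨v, hv, hclique⟩ := hG.exists_simplicial_mem (L := [a, b, c, d]) (by simp) (by simp)
  simp only [List.mem_cons, List.not_mem_nil, or_false] at hv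
  rcases hv with rfl | rfl | rfl | rfl
  · exact hbd (hclique b (by simp) d (by simp) hab hda.symm hbd')
  · exact hac (hclique a (by simp) c (by simp) hab.symm hbc hac')
  · exact hbd (hclique b (by simp) d (by simp) hbc.symm hcd hbd')
  · exact hac (hclique a (by simp) c (by simp) hda hcd.symm hac')

theorem no_five_hole (hG : IsLocallyInterval G) {a b c d e : V} (hP : IsInducedP4 G a b c d)
    (hde : G.Adj d e) (hea : G.Adj e a) (hbe : ¬ G.Adj b e) (hce : ¬ G.Adj c e) : False := by
  obtain ⟨v, hv, hclique⟩ := hG.exists_simplicial_mem (L := [a, b, c, d, e]) (by simp) (by simp)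
  obtain ⟨hab, hbc, hcd, hac, had, hbd⟩ := hP
  simp only [List.mem_cons, List.not_mem_nil, or_false] at hv
  rcases hv with rfl | rfl | rfl | rfl | rfl
  · exact hbe (hclique b (by simp) e (by simp) hab hea.symm (by rintro rfl; exact hce hbc.symm))
  · exact hac (hclique a (by simp) c (by simp) hab.symm hbc (by rintro rfl; exact had hcd))
  · exact hbd (hclique b (by simp) d (by simp) hbc.symm hcd (by rintro rfl; exact hbe hde))
  · exact hce (hclique c (by simp) e (by simp) hcd.symm hde (by rintro rfl; exact hbe hbc))
  · exact had (hclique a (by simp) d (by simp) hea hde.symm (by rintro rfl; exact hac hcd.symm))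

theorem no_long_claw (hG : IsLocallyInterval G) {a a' z b b' c c' : V}
    (hP : IsInducedP5 G a' a z b b') (hzc : G.Adj z c) (hcc' : G.Adj c c')
    (ha'c : ¬ G.Adj a' c) (hb'c : ¬ G.Adj b' c) (hac' : ¬ G.Adj a c') (hbc' : ¬ G.Adj b c')
    (hzc' : ¬ G.Adj z c') (ha'c' : ¬ G.Adj a' c') (hb'c' : ¬ G.Adj b' c') : False := by
  obtain ⟨⟨ha, haz, hzb, ha'z, ha'b, -⟩, hb, ha'b', hab', hzb'⟩ := hP
  refine hG.no_asteroidal_triple (L := [a, a', z, b, b', c, c']) le_rfl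
    (G.ne_of_adj_of_not_adj ha (mt G.adj_symm hab'))
    (G.ne_of_adj_of_not_adj hb.symm (mt G.adj_symm hbc'))
    (G.ne_of_adj_of_not_adj hcc'.symm ha'c)
    (.cons ha (.cons haz (.cons hzb (.cons hb .nil)))) ?_
    (.cons hb.symm (.cons hzb.symm (.cons hzc (.cons hcc' .nil)))) ?_
    (.cons hcc'.symm (.cons hzc.symm (.cons haz.symm (.cons ha.symm .nil)))) ?_ <;>
  simp [*, G.adj_comm _ a', G.adj_comm c b', G.adj_comm c' b']

theorem no_net (hG : IsLocallyInterval G) {a a' b b' c c' : V} (hP : IsInducedP4 G a' a b b')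
    (hac : G.Adj a c) (hbc : G.Adj b c) (hcc' : G.Adj c c')
    (ha'c : ¬ G.Adj a' c) (hb'c : ¬ G.Adj b' c) (hac' : ¬ G.Adj a c') (hbc' : ¬ G.Adj b c')
    (ha'c' : ¬ G.Adj a' c') (hb'c' : ¬ G.Adj b' c') : False := by
  obtain ⟨ha, hab, hb, ha'b, ha'b', hab'⟩ := hP
  refine hG.no_asteroidal_triple (L := [a, a', b, b', c, c']) (by simp)
    (G.ne_of_adj_of_not_adj ha (mt G.adj_symm hab'))
    (G.ne_of_adj_of_not_adj hb.symm (mt G.adj_symm hbc'))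
    (G.ne_of_adj_of_not_adj hcc'.symm ha'c)
    (.cons ha (.cons hab (.cons hb .nil))) ?_
    (.cons hb.symm (.cons hbc (.cons hcc' .nil))) ?_
    (.cons hcc'.symm (.cons hac.symm (.cons ha.symm .nil))) ?_ <;>
  simp [*, G.adj_comm _ a', G.adj_comm c b', G.adj_comm c' b']

theorem no_whipping_top (hG : IsLocallyInterval G) {a a' z b b' u x : V}
    (hP : IsInducedP5 G a' a z b b') (hzu : G.Adj z u) (ha'x : G.Adj a' x) (hb'x : G.Adj b' x)
    (hxu : ¬ G.Adj x u) (ha'u : ¬ G.Adj a' u) (hb'u : ¬ G.Adj b' u) : False := by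
  obtain ⟨⟨ha, haz, hzb, ha'z, ha'b, -⟩, hb, ha'b', hab', hzb'⟩ := hP
  refine hG.no_asteroidal_triple (L := [a, a', z, b, b', u, x]) le_rfl
    (G.ne_of_adj_of_not_adj ha (mt G.adj_symm hab'))
    (G.ne_of_adj_of_not_adj hb'x (mt G.adj_symm hxu))
    (G.ne_of_adj_of_not_adj hzu.symm ha'z)
    (.cons ha'x (.cons hb'x.symm .nil)) ?_
    (.cons hb.symm (.cons hzb.symm (.cons hzu .nil))) ?_
    (.cons hzu.symm (.cons haz.symm (.cons ha.symm .nil))) ?_ <;>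
  simp [*, G.adj_comm _ a', G.adj_comm u b']

theorem no_tent (hG : IsLocallyInterval G) {a a' b b' u x : V}
    (hP : IsInducedP4 G a' a b b')
    (hau : G.Adj a u) (hbu : G.Adj b u) (ha'x : G.Adj a' x) (hb'x : G.Adj b' x)
    (hxu : ¬ G.Adj x u) (ha'u : ¬ G.Adj a' u) (hb'u : ¬ G.Adj b' u) : False := by
  obtain ⟨ha, -, hb, ha'b, ha'b', hab'⟩ := hP
  refine hG.no_asteroidal_triple (L := [a, a', b, b', u, x]) (by simp)
    (G.ne_of_adj_of_not_adj ha (mt G.adj_symm hab'))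
    (G.ne_of_adj_of_not_adj hb'x (mt G.adj_symm hxu))
    (G.ne_of_adj_of_not_adj hbu.symm ha'b)
    (.cons ha'x (.cons hb'x.symm .nil)) ?_
    (.cons hb.symm (.cons hbu .nil)) ?_
    (.cons hau.symm (.cons ha.symm .nil)) ?_ <;>
  simp [*, G.adj_comm _ a', G.adj_comm u b']

end IsLocallyInterval

/-- `h` winds the integers around a chordless cycle of length `n`, so that index arithmetic along
the cycle becomes linear arithmetic in `ℤ`. -/
structure IsWinding (G : SimpleGraph V) (n : ℤ) (h : ℤ → V) : Prop where
  eq_iff : ∀ i j, h i = h j ↔ n ∣ i - j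
  adj_iff : ∀ i j, G.Adj (h i) (h j) ↔ n ∣ i - j - 1 ∨ n ∣ j - i - 1

theorem IsHole.exists_winding {H : Set V} (hH : IsHole G H) :
    ∃ (n : ℤ) (h : ℤ → V), 4 ≤ n ∧ IsWinding G n h ∧ Set.range h = H := by
  obtain ⟨n, hn, f, rfl⟩ := hH
  obtain ⟨m, rfl⟩ : ∃ m, n = m + 2 := ⟨n - 2, by omega⟩
  let g : ZMod (m + 2) → V := f
  have hg : Function.Injective g := f.injective
  have hadj : ∀ i j : ZMod (m + 2), G.Adj (g i) (g j) ↔ i - j = 1 ∨ j - i = 1 := fun i j =>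
    f.map_adj_iff.trans SimpleGraph.cycleGraph_adj
  refine ⟨(m + 2 : ℕ), fun i => g i, by exact_mod_cast hn, ⟨fun i j => ?_, fun i j => ?_⟩, ?_⟩
  · rw [hg.eq_iff, ← ZMod.intCast_zmod_eq_zero_iff_dvd, Int.cast_sub, sub_eq_zero]
  · simp only [hadj, ← ZMod.intCast_zmod_eq_zero_iff_dvd, Int.cast_sub, Int.cast_one, sub_eq_zero]
  · exact (ZMod.intCast_surjective).range_comp g

namespace IsWinding

variable {n : ℤ} {h : ℤ → V}

theorem adj (hh : IsWinding G n h) {i j : ℤ} (hij : j = i + 1) : G.Adj (h i) (h j) :=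
  (hh.adj_iff i j).2 (.inr ⟨0, by omega⟩)

theorem not_adj (hh : IsWinding G n h) {i j : ℤ} (hij : 1 < j - i ∧ j - i < n - 1) :
    ¬ G.Adj (h i) (h j) := by
  rw [hh.adj_iff]
  rintro (hdvd | hdvd)
  · have := Int.le_of_dvd (by omega) (dvd_neg.2 hdvd)
    omega
  · have := Int.le_of_dvd (by omega) hdvd
    omega

theorem ne (hh : IsWinding G n h) {i j : ℤ} (hij : 0 < j - i ∧ j - i < n) : h i ≠ h j := by
  intro hEq
  have := Int.le_of_dvd hij.1 ((hh.eq_iff j i).1 hEq.symm)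
  omega

theorem periodic (hh : IsWinding G n h) : Function.Periodic h n :=
  fun i => (hh.eq_iff _ _).2 ⟨1, by ring⟩

theorem isInducedP4 (hh : IsWinding G n h) (hn : 5 ≤ n) {i j k l : ℤ} (hj : j = i + 1)
    (hk : k = i + 2) (hl : l = i + 3) : IsInducedP4 G (h i) (h j) (h k) (h l) where
  ab := hh.adj hj
  bc := hh.adj (by omega)
  cd := hh.adj (by omega)
  not_ac := hh.not_adj (by omega)
  not_ad := hh.not_adj (by omega)
  not_bd := hh.not_adj (by omega)

theorem isInducedP5 (hh : IsWinding G n h) (hn : 6 ≤ n) (i : ℤ) :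
    IsInducedP5 G (h (i - 2)) (h (i - 1)) (h i) (h (i + 1)) (h (i + 2)) where
  toIsInducedP4 := hh.isInducedP4 (by omega) (by ring) (by ring) (by ring)
  de := hh.adj (by ring)
  not_ae := hh.not_adj (by omega)
  not_be := hh.not_adj (by omega)
  not_ce := hh.not_adj (by omega)

theorem six_le (hG : IsLocallyInterval G) (hh : IsWinding G n h) (hn : 4 ≤ n) : 6 ≤ n := by
  by_contra! hlt
  obtain rfl | rfl : n = 4 ∨ n = 5 := by omega
  · have h30 : G.Adj (h 3) (h 0) := (hh.adj_iff 3 0).2 (.inr ⟨-1, by norm_num⟩)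
    exact hG.no_four_hole (hh.adj (i := 0) (j := 1) rfl) (hh.adj (j := 2) rfl) (hh.adj rfl) h30
      (hh.not_adj (by norm_num)) (hh.not_adj (by norm_num)) (hh.ne (by norm_num))
      (hh.ne (by norm_num))
  · have h40 : G.Adj (h 4) (h 0) := (hh.adj_iff 4 0).2 (.inr ⟨-1, by norm_num⟩)
    exact hG.no_five_hole (hh.isInducedP4 le_rfl (i := 0) rfl rfl rfl) (hh.adj rfl) h40
      (hh.not_adj (by norm_num)) (hh.not_adj (by norm_num))

end IsWinding

theorem IsHole.not_isClique_neighborSet {H : Set V} (hH : IsHole G H) {v : V} (hv : v ∈ H) :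
    ¬ G.IsClique (G.neighborSet v) := by
  obtain ⟨n, h, hn, hh, rfl⟩ := hH.exists_winding
  obtain ⟨i, rfl⟩ := hv
  intro hclique
  refine hh.not_adj (i := i - 1) (j := i + 1) (by omega) (hclique ?_ ?_ (hh.ne (by omega)))
  · exact (hh.adj (by ring)).symm
  · exact hh.adj rfl

/-- The vertex `v` is complete to the set `H`. -/
def CompleteTo (G : SimpleGraph V) (v : V) (H : Set V) : Prop :=
  ∀ u ∈ H, G.Adj u v

/-- The vertex `v` is anticomplete to the set `H`; it is allowed to lie in `H`. -/
def AnticompleteTo (G : SimpleGraph V) (v : V) (H : Set V) : Prop :=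
  ∀ u ∈ H, ¬ G.Adj u v

/-- The vertex `v` is mixed on the set `H`: it has both a neighbour and a nonneighbour in `H`. Every
vertex of `H` counts as its own nonneighbour. -/
def MixedOn (G : SimpleGraph V) (v : V) (H : Set V) : Prop :=
  ¬ CompleteTo G v H ∧ ¬ AnticompleteTo G v H

/-- The vertex `w` spans a gap of `H`: it is the midpoint of an induced path on five vertices
whose four other vertices lie in `H`. When `H` is a hole, the two halves of the path enter a
segment of nonneighbours of `w` from its two ends. -/
def SpansGap (G : SimpleGraph V) (H : Set V) (w : V) : Prop :=
  ∃ a b d e, {a, b, d, e} ⊆ H ∧ IsInducedP5 G a b w d e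

/-- The ways in which a vertex `w` mixed on a hole `H` is attached to it: at a single vertex `c`,
at a single edge `bc`, or at both ends of a gap. -/
inductive Attachment (G : SimpleGraph V) (H : Set V) (w : V) : Prop
  | vertex {a b c d e : V} (hH : {a, b, c, d, e} ⊆ H) (hP : IsInducedP5 G a b c d e)
      (hc : G.Adj c w) (ha : ¬ G.Adj a w) (he : ¬ G.Adj e w)
  | edge {a b c d : V} (hH : {a, b, c, d} ⊆ H) (hP : IsInducedP4 G a b c d)
      (hb : G.Adj b w) (hc : G.Adj c w) (ha : ¬ G.Adj a w) (hd : ¬ G.Adj d w)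
  | gap (hw : SpansGap G H w)

theorem exists_gap_of_periodic {P : ℤ → Prop} {n : ℤ} (hn : 0 < n) (hP : Function.Periodic P n)
    (htrue : ∃ i, P i) (hfalse : ∃ j, ¬ P j) :
    ∃ s t, s + 1 < t ∧ t ≤ s + n ∧ P s ∧ P t ∧ ∀ i, s < i → i < t → ¬ P i := by
  obtain ⟨i, hi⟩ := htrue
  obtain ⟨j, hj⟩ := hfalse
  have exists_near (a : ℤ) : ∃ k ∈ Set.Ico a (a + n), P k := by
    obtain ⟨k, hk, hik⟩ := hP.exists_mem_Ico hn i a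
    exact ⟨k, hk, hik ▸ hi⟩
  obtain ⟨s, ⟨hs, hsj⟩, hsmax⟩ := Int.exists_greatest_of_bdd (P := fun k => P k ∧ k < j)
    ⟨j, fun _ hk => hk.2.le⟩
    ((exists_near (j - n)).imp fun k ⟨hk, hPk⟩ => ⟨hPk, by rw [Set.mem_Ico] at hk; omega⟩)
  obtain ⟨t, ⟨ht, hjt⟩, htmin⟩ := Int.exists_least_of_bdd (P := fun k => P k ∧ j < k)
    ⟨j, fun _ hk => hk.2.le⟩
    ((exists_near (j + 1)).imp fun k ⟨hk, hPk⟩ => ⟨hPk, by rw [Set.mem_Ico] at hk; omega⟩)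
  have hgap : ∀ k, s < k → k < t → ¬ P k := by
    intro k hsk hkt hk
    rcases lt_trichotomy k j with hkj | rfl | hkj
    · exact (hsmax k ⟨hk, hkj⟩).not_gt hsk
    · exact hj hk
    · exact (htmin k ⟨hk, hkj⟩).not_gt hkt
  refine ⟨s, t, by omega, ?_, hs, ht, hgap⟩
  by_contra! hlt
  exact hgap (s + n) (by omega) hlt ((hP s).symm ▸ hs)

theorem IsWinding.exists_gap (hG : IsLocallyInterval G) {n : ℤ} {h : ℤ → V}
    (hh : IsWinding G n h) (hn : 6 ≤ n) {w : V} (hw : w ∉ Set.range h)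
    (hmix : MixedOn G w (Set.range h)) :
    ∃ s t, s + 4 ≤ t ∧ t ≤ s + n ∧ G.Adj (h s) w ∧ G.Adj (h t) w ∧
      ∀ i, s < i → i < t → ¬ G.Adj (h i) w := by
  simp only [MixedOn, CompleteTo, AnticompleteTo, Set.forall_mem_range, not_forall, not_not]
    at hmix
  obtain ⟨s, t, hst, htn, hs, ht, hgap⟩ := exists_gap_of_periodic (P := fun i => G.Adj (h i) w)
    (by omega) (hh.periodic.comp (G.Adj · w)) hmix.2 hmix.1
  refine ⟨s, t, ?_, htn, hs, ht, hgap⟩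
  by_contra! hlt
  obtain rfl | rfl : t = s + 2 ∨ t = s + 3 := by omega
  · exact hG.no_four_hole (hh.adj rfl) (hh.adj (by ring)) ht hs.symm (hh.not_adj (by omega))
      (hgap (s + 1) (by omega) (by omega)) (hh.ne (by omega)) fun hEq => hw ⟨_, hEq⟩
  · exact hG.no_five_hole (hh.isInducedP4 (by omega) rfl rfl rfl) ht hs.symm
      (hgap (s + 1) (by omega) (by omega)) (hgap (s + 2) (by omega) (by omega))

section Attachment

variable {H : Set V}

theorem IsHole.attachment (hG : IsLocallyInterval G) (hH : IsHole G H) {w : V}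
    (hmix : MixedOn G w H) : Attachment G H w := by
  obtain ⟨n, h, hn, hh, rfl⟩ := hH.exists_winding
  replace hn := hh.six_le hG hn
  by_cases hw : w ∈ Set.range h
  · obtain ⟨i, rfl⟩ := hw
    exact .gap ⟨_, _, _, _, by simp [Set.insert_subset_iff], hh.isInducedP5 hn i⟩
  obtain ⟨s, t, hst, htn, hs, ht, hgap⟩ := hh.exists_gap hG hn hw hmix
  have not_adj_before {i : ℤ} (hsi : s < i + n) (hit : i + n < t) : ¬ G.Adj (h i) w := by
    rw [← hh.periodic i]
    exact hgap _ hsi hit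
  obtain rfl | rfl | htn : t = s + n ∨ t = s + n - 1 ∨ t ≤ s + n - 2 := by omega
  · exact .vertex (by simp [Set.insert_subset_iff]) (hh.isInducedP5 hn s) hs
      (not_adj_before (by omega) (by omega)) (hgap _ (by omega) (by omega))
  · have hs' : G.Adj (h (s - 1)) w := by
      rwa [← hh.periodic, sub_add_eq_add_sub]
    exact .edge (by simp [Set.insert_subset_iff])
      (hh.isInducedP4 (by omega) (i := s - 2) (by ring) (by ring) rfl) hs'
      (by simpa using hs) (not_adj_before (by omega) (by omega)) (hgap _ (by omega) (by omega))
  · refine .gap ⟨h (s + 1), h s, h t, h (t - 1), by simp [Set.insert_subset_iff], ?_⟩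
    exact {
      ab := (hh.adj rfl).symm
      bc := hs
      cd := ht.symm
      de := (hh.adj (by ring)).symm
      not_ac := hgap _ (by omega) (by omega)
      not_ad := hh.not_adj (by omega)
      not_ae := hh.not_adj (by omega)
      not_bd := hh.not_adj (by omega)
      not_be := hh.not_adj (by omega)
      not_ce := fun hadj => hgap _ (by omega) (by omega) hadj.symm }

/- If `x` and `u` were nonadjacent, they would close a whipping top, a tent or a `C₄` over the
attachment of `u`. -/
theorem CompleteTo.adj_of_mixedOn (hG : IsLocallyInterval G) (hH : IsHole G H) {x u : V}
    (hx : CompleteTo G x H) (hu : MixedOn G u H) : G.Adj x u := by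
  by_contra hxu
  cases hH.attachment hG hu with
  | vertex hsub hP hc ha he =>
    exact hG.no_whipping_top hP hc (hx _ (hsub (by simp))) (hx _ (hsub (by simp))) hxu ha he
  | edge hsub hP hb hc ha hd =>
    exact hG.no_tent hP hb hc (hx _ (hsub (by simp))) (hx _ (hsub (by simp))) hxu ha hd
  | gap hgap =>
    obtain ⟨a, b, d, e, hsub, hP⟩ := hgap
    refine hG.no_four_hole hP.cd (hx d (hsub (by simp))) (hx b (hsub (by simp))).symm hP.bc
      (fun hux => hxu hux.symm) (fun hdb => hP.not_bd hdb.symm) ?_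
      (G.ne_of_adj_of_not_adj hP.de hP.not_be)
    rintro rfl
    exact hP.not_ac (hx a (hsub (by simp)))

theorem MixedOn.spansGap_of_adj_anticompleteTo (hG : IsLocallyInterval G) (hH : IsHole G H)
    {w c : V} (hw : MixedOn G w H) (hc : AnticompleteTo G c H) (hwc : G.Adj w c) :
    SpansGap G H w := by
  cases hH.attachment hG hw with
  | vertex hsub hP hz ha he =>
    exact (hG.no_long_claw hP hz hwc ha he (hc _ (hsub (by simp))) (hc _ (hsub (by simp)))
      (hc _ (hsub (by simp))) (hc _ (hsub (by simp))) (hc _ (hsub (by simp)))).elim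
  | edge hsub hP hb hz ha hd =>
    exact (hG.no_net hP hb hz hwc ha hd (hc _ (hsub (by simp))) (hc _ (hsub (by simp)))
      (hc _ (hsub (by simp))) (hc _ (hsub (by simp)))).elim
  | gap hgap => exact hgap

theorem SpansGap.adj_of_adj_of_adj (hG : IsLocallyInterval G) {w c d : V}
    (hw : SpansGap G H w) (hc : AnticompleteTo G c H) (hd : AnticompleteTo G d H)
    (hwc : G.Adj w c) (hcd : G.Adj c d) : G.Adj w d := by
  obtain ⟨p', p, q, q', hsub, hP⟩ := hw
  by_contra hwd
  exact hG.no_long_claw hP hwc hcd (hc p' (hsub (by simp))) (hc q' (hsub (by simp)))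
    (hd p (hsub (by simp))) (hd q (hsub (by simp))) hwd (hd p' (hsub (by simp)))
    (hd q' (hsub (by simp)))

theorem SpansGap.adj_of_completeTo (hG : IsLocallyInterval G) {w c x : V}
    (hw : SpansGap G H w) (hx : CompleteTo G x H) (hc : AnticompleteTo G c H)
    (hwc : G.Adj w c) : G.Adj x c := by
  obtain ⟨p', p, q, q', hsub, hP⟩ := hw
  by_contra hxc
  exact hG.no_whipping_top hP hwc (hx p' (hsub (by simp))) (hx q' (hsub (by simp))) hxc
    (hc p' (hsub (by simp))) (hc q' (hsub (by simp)))

/- If `w` and `w'` were nonadjacent, then, there being no `C₄` and no `C₅` through `w`, `c` and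
`w'`, the induced path through `w` and its leg `c`, `w'` would form a long claw. -/
theorem SpansGap.adj_of_common_neighbor (hG : IsLocallyInterval G) {w w' c : V}
    (hw : SpansGap G H w) (hc : AnticompleteTo G c H) (hwc : G.Adj w c) (hw'c : G.Adj w' c)
    (hne : w ≠ w') : G.Adj w w' := by
  obtain ⟨p', p, q, q', hsub, hP⟩ := hw
  by_contra hww'
  have no_four {y y' : V} (hy : y ∈ H) (hy' : y' ∈ H) (hyy' : G.Adj y y') (hwy : G.Adj w y) :
      ¬ G.Adj y w' := fun hyw' =>
    hG.no_four_hole hwy hyw' hw'c hwc.symm hww' (hc y hy) hne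
      (G.ne_of_adj_of_not_adj hyy' fun hcy' => hc y' hy' hcy'.symm)
  have no_five {y y' : V} (hy : y ∈ H) (hy' : y' ∈ H) (hyy' : G.Adj y y') (hwy : G.Adj w y)
      (hwy' : ¬ G.Adj w y') : ¬ G.Adj y' w' := fun hyw' =>
    hG.no_five_hole ⟨hwy, hyy', hyw', hwy', hww', no_four hy hy' hyy' hwy⟩ hw'c hwc.symm (hc y hy)
      (hc y' hy')
  have hp := hsub (show p ∈ _ by simp)
  have hp' := hsub (show p' ∈ _ by simp)
  have hq := hsub (show q ∈ _ by simp)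
  have hq' := hsub (show q' ∈ _ by simp)
  exact hG.no_long_claw hP hwc hw'c.symm (hc p' hp') (hc q' hq')
    (no_four hp hp' hP.ab.symm hP.bc.symm) (no_four hq hq' hP.de hP.cd) hww'
    (no_five hp hp' hP.ab.symm hP.bc.symm fun hadj => hP.not_ac hadj.symm)
    (no_five hq hq' hP.de hP.cd hP.not_ce)

end Attachment

section Modules

variable {H : Set V}

theorem IsHole.not_isClique (hH : IsHole G H) : ¬ G.IsClique H := by
  obtain ⟨n, h, hn, hh, rfl⟩ := hH.exists_winding
  exact fun hclique => hh.not_adj (i := 0) (j := 2) (by omega)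
    (hclique ⟨0, rfl⟩ ⟨2, rfl⟩ (hh.ne (by omega)))

theorem IsHole.nontrivial (hH : IsHole G H) : H.Nontrivial :=
  Set.not_subsingleton_iff.1 fun hsub => hH.not_isClique (hsub.pairwise _)

theorem IsHole.mixedOn_of_mem (hH : IsHole G H) {v : V} (hv : v ∈ H) : MixedOn G v H := by
  refine ⟨fun hcomplete => G.irrefl (hcomplete v hv), fun hanti => ?_⟩
  obtain ⟨n, h, -, hh, rfl⟩ := hH.exists_winding
  obtain ⟨i, rfl⟩ := hv
  exact hanti _ ⟨i + 1, rfl⟩ (hh.adj rfl).symm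

/-- The vertices mixed on `H`, and those anticomplete to `H` with a neighbour mixed on `H`. -/
def attachedSet (G : SimpleGraph V) (H : Set V) : Set V :=
  {v | MixedOn G v H ∨ AnticompleteTo G v H ∧ ∃ w, MixedOn G w H ∧ G.Adj w v}

theorem CompleteTo.adj_of_mem_attachedSet (hG : IsLocallyInterval G) (hH : IsHole G H) {x v : V}
    (hx : CompleteTo G x H) (hv : v ∈ attachedSet G H) : G.Adj x v := by
  obtain hv | ⟨hv, w, hw, hwv⟩ := hv
  · exact hx.adj_of_mixedOn hG hH hv
  · exact (hw.spansGap_of_adj_anticompleteTo hG hH hv hwv).adj_of_completeTo hG hx hv hwv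

theorem completeTo_of_adj_of_notMem_attachedSet (hG : IsLocallyInterval G) (hH : IsHole G H)
    {v y : V} (hv : v ∈ attachedSet G H) (hvy : G.Adj v y) (hy : y ∉ attachedSet G H) :
    CompleteTo G y H := by
  by_contra hcomplete
  by_cases hanti : AnticompleteTo G y H
  · refine hy (.inr ⟨hanti, ?_⟩)
    obtain hv | ⟨hv, w, hw, hwv⟩ := hv
    · exact ⟨v, hv, hvy⟩
    · have hgap := hw.spansGap_of_adj_anticompleteTo hG hH hv hwv
      exact ⟨w, hw, hgap.adj_of_adj_of_adj hG hv hanti hwv hvy⟩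
  · exact hy (.inl ⟨hcomplete, hanti⟩)

theorem isModule_attachedSet (hG : IsLocallyInterval G) (hH : IsHole G H) :
    IsModule G (attachedSet G H) := by
  have adj_of_adj {u v x : V} (hu : u ∈ attachedSet G H) (hv : v ∈ attachedSet G H)
      (hx : x ∉ attachedSet G H) (hux : G.Adj u x) : G.Adj v x :=
    ((completeTo_of_adj_of_notMem_attachedSet hG hH hu hux hx).adj_of_mem_attachedSet hG hH
      hv).symm
  exact fun u hu v hv x hx => ⟨adj_of_adj hu hv hx, adj_of_adj hv hu hx⟩

theorem IsHole.not_completeTo (hG : IsLocallyInterval G)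
    (hM : ∀ M : Set V, IsNontrivialModule G M → G.IsClique M) (hH : IsHole G H) (x : V) :
    ¬ CompleteTo G x H := by
  have hsub : H ⊆ attachedSet G H := fun v hv => .inl (hH.mixedOn_of_mem hv)
  have huniv : attachedSet G H = Set.univ := by
    by_contra hne
    exact hH.not_isClique
      ((hM _ ⟨isModule_attachedSet hG hH, hH.nontrivial.mono hsub, hne⟩).subset hsub)
  exact fun hx => G.irrefl (hx.adj_of_mem_attachedSet hG hH (huniv ▸ Set.mem_univ x))

/-- The vertices that can be reached from `u` through vertices anticomplete to `H`. If `u` itself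
is anticomplete to `H`, this is its component among such vertices. -/
def farComponent (G : SimpleGraph V) (H : Set V) (u : V) : Set V :=
  {v | Relation.ReflTransGen (fun x y => G.Adj x y ∧ AnticompleteTo G y H) u v}

theorem self_mem_farComponent (u : V) : u ∈ farComponent G H u :=
  .refl

theorem AnticompleteTo.of_mem_farComponent {u v : V} (hu : AnticompleteTo G u H)
    (hv : v ∈ farComponent G H u) : AnticompleteTo G v H := by
  obtain rfl | ⟨_, -, -, hv⟩ := Relation.ReflTransGen.cases_tail hv
  exacts [hu, hv]

theorem not_anticompleteTo_of_adj_farComponent {u v y : V} (hv : v ∈ farComponent G H u)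
    (hvy : G.Adj v y) (hy : y ∉ farComponent G H u) : ¬ AnticompleteTo G y H :=
  fun hanti => hy (hv.tail ⟨hvy, hanti⟩)

theorem MixedOn.adj_iff_of_mem_farComponent (hG : IsLocallyInterval G) (hH : IsHole G H)
    {u v w : V} (hu : AnticompleteTo G u H) (hw : MixedOn G w H)
    (hv : v ∈ farComponent G H u) : G.Adj w v ↔ G.Adj w u := by
  have adj_of_adj {c d : V} (hc : AnticompleteTo G c H) (hd : AnticompleteTo G d H)
      (hcd : G.Adj c d) (hwc : G.Adj w c) : G.Adj w d :=
    (hw.spansGap_of_adj_anticompleteTo hG hH hc hwc).adj_of_adj_of_adj hG hc hd hwc hcd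
  induction hv with
  | refl => rfl
  | tail hc hcd ih =>
    have hc := hu.of_mem_farComponent hc
    exact .trans ⟨adj_of_adj hcd.2 hc hcd.1.symm, adj_of_adj hc hcd.2 hcd.1⟩ ih

theorem isModule_farComponent (hG : IsLocallyInterval G)
    (hM : ∀ M : Set V, IsNontrivialModule G M → G.IsClique M) (hH : IsHole G H) {u : V}
    (hu : AnticompleteTo G u H) : IsModule G (farComponent G H u) := by
  have adj_of_adj {v v' y : V} (hv : v ∈ farComponent G H u) (hv' : v' ∈ farComponent G H u)
      (hy : y ∉ farComponent G H u) (hvy : G.Adj v y) : G.Adj v' y := by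
    have hmix : MixedOn G y H :=
      ⟨hH.not_completeTo hG hM y, not_anticompleteTo_of_adj_farComponent hv hvy hy⟩
    have hyu := (hmix.adj_iff_of_mem_farComponent hG hH hu hv).1 hvy.symm
    exact ((hmix.adj_iff_of_mem_farComponent hG hH hu hv').2 hyu).symm
  exact fun v hv v' hv' y hy => ⟨adj_of_adj hv hv' hy, adj_of_adj hv' hv hy⟩

theorem AnticompleteTo.isClique_farComponent (hG : IsLocallyInterval G)
    (hM : ∀ M : Set V, IsNontrivialModule G M → G.IsClique M) (hH : IsHole G H) {u : V}
    (hu : AnticompleteTo G u H) : G.IsClique (farComponent G H u) := by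
  obtain hsub | hnontrivial := (farComponent G H u).subsingleton_or_nontrivial
  · exact hsub.pairwise _
  refine hM _ ⟨isModule_farComponent hG hM hH hu, hnontrivial, fun huniv => ?_⟩
  obtain ⟨v, hv⟩ := hH.nontrivial.nonempty
  exact (hH.mixedOn_of_mem hv).2 (hu.of_mem_farComponent (huniv ▸ Set.mem_univ v))

theorem AnticompleteTo.isClique_neighborSet (hG : IsLocallyInterval G)
    (hM : ∀ M : Set V, IsNontrivialModule G M → G.IsClique M) (hH : IsHole G H) {u : V}
    (hu : AnticompleteTo G u H) : G.IsClique (G.neighborSet u) := by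
  have hmod := isModule_farComponent hG hM hH hu
  have huC : u ∈ farComponent G H u := self_mem_farComponent u
  intro a (ha : G.Adj u a) b (hb : G.Adj u b) hab
  by_cases haC : a ∈ farComponent G H u <;> by_cases hbC : b ∈ farComponent G H u
  · exact hu.isClique_farComponent hG hM hH haC hbC hab
  · exact (hmod u huC a haC b hbC).1 hb
  · exact ((hmod u huC b hbC a haC).1 ha).symm
  · have hmix : MixedOn G a H :=
      ⟨hH.not_completeTo hG hM a, not_anticompleteTo_of_adj_farComponent huC ha haC⟩
    exact (hmix.spansGap_of_adj_anticompleteTo hG hH hu ha.symm).adj_of_common_neighbor hG hu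
      ha.symm hb.symm hab

end Modules

theorem anticompleteTo_of_notMem_closedNeighborhood {H : Set V} {v : V}
    (hv : v ∉ closedNeighborhood G H) : AnticompleteTo G v H :=
  fun u hu huv => hv (Set.mem_iUnion₂.2 ⟨u, hu, .inr huv⟩)

theorem IsHole.subset_closedNeighborhood (hG : IsLocallyInterval G)
    (hM : ∀ M : Set V, IsNontrivialModule G M → G.IsClique M) {H₁ H₂ : Set V}
    (h₁ : IsHole G H₁) (h₂ : IsHole G H₂) : H₁ ⊆ closedNeighborhood G H₂ := by
  intro v hv
  by_contra hfar
  exact h₁.not_isClique_neighborSet hv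
    ((anticompleteTo_of_notMem_closedNeighborhood hfar).isClique_neighborSet hG hM h₂)

theorem theorem2p2_general (hG : ∀ X : Finset V, IsMinimalForbidden G X → 7 < X.card)
    (hM : ∀ M : Set V, IsNontrivialModule G M → G.IsClique M) {H₁ H₂ : Set V}
    (h₁ : IsHole G H₁) (h₂ : IsHole G H₂) : Congenial G H₁ H₂ :=
  have hlocal := isLocallyInterval_of_seven_lt_card hG
  ⟨h₁.subset_closedNeighborhood hlocal hM h₂, h₂.subset_closedNeighborhood hlocal hM h₁⟩

end HolePaper

theorem theorem2p2 {V : Type*} [Finite V] (G : SimpleGraph V) (hG : HolePaper.IsReduced G)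
    (H₁ H₂ : Set V) (h₁ : HolePaper.IsHole G H₁) (h₂ : HolePaper.IsHole G H₂) :
    HolePaper.Congenial G H₁ H₂ :=
  HolePaper.theorem2p2_general
    (fun X hX => by_contra fun hcard => hG.1 ⟨X, hX, by omega⟩) hG.2 h₁ h₂
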